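/- The spread of a finite simple graph $G$ is the difference $\lambda_1(G)-\lambda_n(G)$ between the largest and the smallest eigenvalue of its adjacency matrix, i.e. the diameter of the spectrum of the adjacency matrix $A(G)$. For every integer $t\ge 2$ there is an $N=N(t)$ such that the following holds for all $n\ge N$. Let $G$ be a graph which attains the maximum spread among all $n$-vertex graphs that do not contain $K_{2,t}$ as a minor. Then $G$ has a vertex of degree $n-1$. More precisely, $A(G)$ has an eigenvector $\mathbf{x}$ for the eigenvalue $\lambda_1(G)$ with all entries positive and largest entry equal to $1$, and for every such $\mathbf{x}$, each vertex $u_0$ with $\mathbf{x}_{u_0}=1$ has degree $n-1$. -/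

import Mathlib

/-- `H` is isomorphic to a graph obtained from `G` by contracting edges: there is a map `f` from the
vertices of `G` to those of `H` all of whose fibres induce connected (hence nonempty) subgraphs,
and two distinct vertices of `H` are adjacent exactly when `G` has an edge between their fibres. -/
def SimpleGraph.IsContractionOf {V W : Type*} (H : SimpleGraph W) (G : SimpleGraph V) : Prop :=
  ∃ f : V → W, (∀ a, (G.induce (f ⁻¹' {a})).Connected) ∧
    ∀ a b, H.Adj a b ↔ a ≠ b ∧ ∃ x y, f x = a ∧ f y = b ∧ G.Adj x y

/-- `H` is a minor of `G`: a graph isomorphic to `H` can be obtained from a subgraph of `G` by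
contracting edges. -/
def SimpleGraph.IsMinorOf {V W : Type*} (H : SimpleGraph W) (G : SimpleGraph V) : Prop :=
  ∃ S : G.Subgraph, H.IsContractionOf S.coe

/-- `G` is `K_{2,t}`-minor-free. -/
def SimpleGraph.K2MinorFree {V : Type*} (t : ℕ) (G : SimpleGraph V) : Prop :=
  ¬ (completeBipartiteGraph (Fin 2) (Fin t)).IsMinorOf G

open Classical in
/-- The real adjacency matrix. -/
noncomputable def SimpleGraph.realAdj {V : Type*} (G : SimpleGraph V) : Matrix V V ℝ :=
  G.adjMatrix ℝ

/-- The spread of a finite graph: the diameter of the spectrum of its adjacency matrix, i.e. the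
largest distance between two of its eigenvalues. -/
noncomputable def SimpleGraph.spread {V : Type*} [Fintype V] [DecidableEq V] (G : SimpleGraph V) : ℝ :=
  Metric.diam (spectrum ℝ G.realAdj)

/-- The largest eigenvalue of the adjacency matrix of a finite nonempty graph. -/
noncomputable def SimpleGraph.lambdaOne {V : Type*} [Fintype V] [DecidableEq V] (G : SimpleGraph V) : ℝ :=
  sSup (spectrum ℝ G.realAdj)

/-- `G` attains the maximum spread among all `K_{2,t}`-minor-free graphs on its vertex set. -/
def SimpleGraph.IsMaxSpread {V : Type*} [Fintype V] [DecidableEq V] (t : ℕ)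
    (G : SimpleGraph V) : Prop :=
  G.K2MinorFree t ∧ ∀ H : SimpleGraph V, H.K2MinorFree t → H.spread ≤ G.spread

/-- `x` is an eigenvector for the largest eigenvalue with all entries positive, normalized so that
its maximum entry is `1`. -/
def SimpleGraph.IsPerronVector {V : Type*} [Fintype V] [DecidableEq V]
    (G : SimpleGraph V) (x : V → ℝ) : Prop :=
  G.realAdj.mulVec x = G.lambdaOne • x ∧ (∀ v, 0 < x v) ∧ (∀ v, x v ≤ 1) ∧ ∃ v, x v = 1

/-!
Write `λ₁` and `λₙ` for the extreme eigenvalues of a `K_{2,t}`-minor-free graph `G` of maximum spread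
on `n` vertices, and `m = √(n - 1)`.

*Sparsity.* An edge of a graph without a `K_{2,t}` subgraph lies in fewer than `t` triangles, so
contracting it removes one vertex and at most `t` edges. By induction, every vertex set `s` spans at
most `t|s|` edges (`K2MinorFree.card_adjPairs_le`). Two vertices have fewer than `t` common neighbours.

*Eigenvalues.* Let `y` be the entrywise absolute value of an eigenvector for the eigenvalue `±ρ`,
scaled so that its largest entry is `y u = 1`. Sparsity gives `ρ ∑ y ≤ 2tn`, and counting walks of
length two from `u` gives `ρ² ≤ d(u) + t ∑ y`. For `ρ = λ₁` this is `λ₁ ≤ m + O(1)`. The star has spread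
at least `2m` and no `K_{2,t}`-minor, so `λ₁ ≥ m` and `-λₙ ≥ m - O(1)`
(`IsMaxSpread.lambdaOne_le_and_le_lambdaMin`).

*Eigenvectors.* Hence, for both eigenvalues, `u` has only `O(m)` non-neighbours. As two vertices of
such large degree would have many common neighbours, the vertex `u` is the same for `λ₁` and `λₙ`.
Counting walks of length two from `v ≠ u` gives `y v = O(1/m)`. A non-neighbour `v` of `u` has fewer
than `t` neighbours adjacent to `u`, and the total weight of the non-neighbours is `O(1/m)` by
sparsity, so that `ρ y v = O(1/m) < 1` (`IsSubeigenvector.mul_lt_one_of_mem_nonNeighbors`).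

*Moving a vertex.* If `u` had a non-neighbour `v`, delete all edges at `v` and join `v` to `u` instead.
No `K_{2,t}`-minor arises, because `K_{2,t}` has minimum degree at least two
(`K2MinorFree.movePendant`). The test vectors obtained from the two eigenvectors by changing the entry
at `v` to `1/λ₁` and `1/λₙ` show that `λ₁` increases and `λₙ` decreases, which contradicts maximality
(`spread_lt_spread_movePendant`). So `u` is adjacent to all other vertices; in particular `G` is
connected, and the absolute value of the eigenvector for `λ₁` is a positive eigenvector.
-/

open Finset Matrix

namespace SimpleGraph

/-! ### Minors through branch sets -/

section Models

variable {V W : Type*}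

theorem connected_iff_forall_closed (G : SimpleGraph V) :
    G.Connected ↔ Nonempty V ∧ ∀ P : V → Prop, (∃ x, P x) →
      (∀ x y, G.Adj x y → P x → P y) → ∀ y, P y := by
  constructor
  · intro h
    refine ⟨h.nonempty, fun P ⟨x, hx⟩ hP y => ?_⟩
    obtain ⟨p⟩ := h.preconnected x y
    induction p with
    | nil => exact hx
    | cons hadj _ ih => exact ih (hP _ _ hadj hx)
  · rintro ⟨hne, h⟩
    refine { preconnected := fun x y => ?_, nonempty := hne }
    exact h (fun y => G.Reachable x y) ⟨x, Reachable.refl x⟩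
      (fun a b hab ha => ha.trans hab.reachable) y

/-- Connectedness of an induced subgraph, as the absence of proper nonempty closed subsets. -/
theorem induce_connected_iff_forall_closed (G : SimpleGraph V) (B : Set V) :
    (G.induce B).Connected ↔ B.Nonempty ∧ ∀ P : V → Prop, (∃ x ∈ B, P x) →
      (∀ x ∈ B, ∀ y ∈ B, G.Adj x y → P x → P y) → ∀ y ∈ B, P y := by
  rw [connected_iff_forall_closed, Set.nonempty_coe_sort]
  refine and_congr_right fun _ => ⟨fun h P ⟨x, hx, hPx⟩ hP y hy => ?_, fun h P ⟨x, hPx⟩ hP y => ?_⟩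
  · exact h (fun z => P z) ⟨⟨x, hx⟩, hPx⟩ (fun a b hab => hP a a.2 b b.2 hab) ⟨y, hy⟩
  · obtain ⟨hy, h'⟩ := h (fun z => ∃ hz : z ∈ B, P ⟨z, hz⟩) ⟨x, x.2, x.2, hPx⟩
      (fun a ha b hb hab ⟨_, hPa⟩ => ⟨hb, hP ⟨a, ha⟩ ⟨b, hb⟩ hab hPa⟩) y y.2
    exact h'

/-- A family `B` of branch sets exhibiting `H` as a minor of `G`: disjoint connected vertex sets
indexed by the vertices of `H`, joined by an edge of `G` whenever their indices are adjacent. -/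
structure IsBranchFamily (H : SimpleGraph W) (G : SimpleGraph V) (B : W → Set V) : Prop where
  connected : ∀ a, (G.induce (B a)).Connected
  disjoint : ∀ a b x, x ∈ B a → x ∈ B b → a = b
  exists_adj : ∀ a b, H.Adj a b → ∃ x ∈ B a, ∃ y ∈ B b, G.Adj x y

theorem isMinorOf_iff_exists_isBranchFamily (H : SimpleGraph W) (G : SimpleGraph V) :
    H.IsMinorOf G ↔ ∃ B : W → Set V, IsBranchFamily H G B := by
  constructor
  · rintro ⟨S, f, hconn, hadj⟩
    refine ⟨fun a => Subtype.val '' (f ⁻¹' {a}), fun a => ?_, ?_, fun a b hab => ?_⟩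
    · obtain ⟨⟨x, hx⟩, h⟩ := (induce_connected_iff_forall_closed _ _).1 (hconn a)
      refine (induce_connected_iff_forall_closed _ _).2 ⟨⟨x, x, hx, rfl⟩, ?_⟩
      rintro P ⟨_, ⟨z, hz, rfl⟩, hPz⟩ hP _ ⟨y, hy, rfl⟩
      exact h (fun z => P z) ⟨z, hz, hPz⟩
        (fun p hp q hq hpq => hP p ⟨p, hp, rfl⟩ q ⟨q, hq, rfl⟩ hpq.adj_sub) y hy
    · rintro a b _ ⟨x, hx, rfl⟩ ⟨y, hy, hxy⟩
      obtain rfl : y = x := Subtype.ext hxy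
      exact (Set.mem_singleton_iff.1 hx).symm.trans hy
    · obtain ⟨-, x, y, hx, hy, hxy⟩ := (hadj a b).1 hab
      exact ⟨x, ⟨x, hx, rfl⟩, y, ⟨y, hy, rfl⟩, hxy.adj_sub⟩
  · rintro ⟨B, hB⟩
    let S : G.Subgraph :=
      { verts := {x | ∃ a, x ∈ B a}
        Adj := fun x y => G.Adj x y ∧ ∃ a b, x ∈ B a ∧ y ∈ B b ∧ (a = b ∨ H.Adj a b)
        adj_sub := fun h => h.1
        edge_vert := fun ⟨_, a, _, hx, _⟩ => ⟨a, hx⟩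
        symm := ⟨fun x y ⟨h, a, b, hx, hy, hab⟩ =>
          ⟨h.symm, b, a, hy, hx, hab.imp Eq.symm Adj.symm⟩⟩ }
    have hf : ∀ x : S.verts, ∃ a, (x : V) ∈ B a := fun x => x.2
    choose f hf using hf
    have hf' : ∀ (x : S.verts) a, (x : V) ∈ B a → f x = a := fun x a hx =>
      hB.disjoint _ _ _ (hf x) hx
    refine ⟨S, f, fun a => ?_, fun a b => ⟨fun hab => ⟨hab.ne, ?_⟩, ?_⟩⟩
    · obtain ⟨⟨x, hx⟩, h⟩ := (induce_connected_iff_forall_closed _ _).1 (hB.connected a)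
      refine (induce_connected_iff_forall_closed _ _).2
        ⟨⟨⟨x, a, hx⟩, hf' _ _ hx⟩, fun P ⟨z, hz, hPz⟩ hP y hy => ?_⟩
      have hmem : ∀ z : S.verts, z ∈ f ⁻¹' {a} → (z : V) ∈ B a := fun z hz => by
        have := hf z
        rwa [Set.mem_singleton_iff.1 hz] at this
      obtain ⟨_, h'⟩ := h (fun z => ∃ hz : z ∈ S.verts, P ⟨z, hz⟩) ⟨z, hmem z hz, z.2, hPz⟩
        (fun p hp q hq hpq ⟨_, hPp⟩ => ⟨⟨a, hq⟩, hP ⟨p, a, hp⟩ (hf' _ _ hp) ⟨q, a, hq⟩ (hf' _ _ hq)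
          ⟨hpq, a, a, hp, hq, Or.inl rfl⟩ hPp⟩) y (hmem y hy)
      exact h'
    · obtain ⟨x, hx, y, hy, hxy⟩ := hB.exists_adj a b hab
      exact ⟨⟨x, a, hx⟩, ⟨y, b, hy⟩, hf' _ _ hx, hf' _ _ hy, hxy, a, b, hx, hy, Or.inr hab⟩
    · rintro ⟨hne, x, y, rfl, rfl, hxy, a, b, hx, hy, hab⟩
      rw [hf' x a hx, hf' y b hy] at hne ⊢
      exact hab.resolve_left hne

theorem K2MinorFree.not_isBranchFamily {t : ℕ} {G : SimpleGraph V} (hG : G.K2MinorFree t)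
    (B : Fin 2 ⊕ Fin t → Set V) : ¬ IsBranchFamily (completeBipartiteGraph (Fin 2) (Fin t)) G B :=
  fun hB => hG ((isMinorOf_iff_exists_isBranchFamily _ _).2 ⟨B, hB⟩)

theorem k2MinorFree_of_forall_not_isBranchFamily {t : ℕ} {G : SimpleGraph V}
    (h : ∀ B : Fin 2 ⊕ Fin t → Set V,
      ¬ IsBranchFamily (completeBipartiteGraph (Fin 2) (Fin t)) G B) : G.K2MinorFree t := by
  intro hG
  obtain ⟨B, hB⟩ := (isMinorOf_iff_exists_isBranchFamily _ _).1 hG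
  exact h B hB

theorem IsBranchFamily.mono {H : SimpleGraph W} {G G' : SimpleGraph V} {B : W → Set V}
    (hB : IsBranchFamily H G B) (h : G ≤ G') : IsBranchFamily H G' B where
  connected a := (hB.connected a).mono (comap_monotone _ h)
  disjoint := hB.disjoint
  exists_adj a b hab := by
    obtain ⟨x, hx, y, hy, hxy⟩ := hB.exists_adj a b hab
    exact ⟨x, hx, y, hy, h hxy⟩

theorem K2MinorFree.mono {t : ℕ} {G G' : SimpleGraph V} (hG' : G'.K2MinorFree t) (h : G ≤ G') :
    G.K2MinorFree t :=
  k2MinorFree_of_forall_not_isBranchFamily fun B hB => hG'.not_isBranchFamily B (hB.mono h)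

/-- In `K_{2,t}` with `t ≥ 2`, every vertex has two distinct neighbours. -/
theorem exists_two_adj_completeBipartiteGraph {t : ℕ} (ht : 2 ≤ t) (a : Fin 2 ⊕ Fin t) :
    ∃ b c, b ≠ c ∧ (completeBipartiteGraph (Fin 2) (Fin t)).Adj a b ∧
      (completeBipartiteGraph (Fin 2) (Fin t)).Adj a c := by
  rcases a with a | a
  · exact ⟨Sum.inr ⟨0, by omega⟩, Sum.inr ⟨1, by omega⟩, by simp, by simp, by simp⟩
  · exact ⟨Sum.inl 0, Sum.inl 1, by simp, by simp, by simp⟩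

/-- The graph obtained from `G` by deleting all edges at `v` and then joining `v` to `u`. -/
def movePendant (G : SimpleGraph V) (v u : V) : SimpleGraph V where
  Adj x y := (x ≠ v ∧ y ≠ v ∧ G.Adj x y) ∨ (u ≠ v ∧ ((x = v ∧ y = u) ∨ (x = u ∧ y = v)))
  symm := ⟨fun x y h => by
    rcases h with ⟨h1, h2, h3⟩ | ⟨h, h1 | h1⟩
    · exact Or.inl ⟨h2, h1, h3.symm⟩
    · exact Or.inr ⟨h, Or.inr h1.symm⟩
    · exact Or.inr ⟨h, Or.inl h1.symm⟩⟩
  loopless := ⟨fun x h => by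
    rcases h with ⟨_, _, h⟩ | ⟨h, ⟨h1, h2⟩ | ⟨h1, h2⟩⟩
    · exact h.ne rfl
    · exact h (h2.symm.trans h1)
    · exact h (h1.symm.trans h2)⟩

theorem movePendant_adj_left {G : SimpleGraph V} {v u : V} (y : V) :
    (G.movePendant v u).Adj v y ↔ u ≠ v ∧ y = u := by
  simp only [movePendant, ne_eq, not_true_eq_false, false_and, true_and, false_or]
  constructor
  · rintro ⟨h, h1 | h1⟩
    · exact ⟨h, h1⟩
    · exact absurd h1.1.symm h
  · exact fun h => ⟨h.1, Or.inl h.2⟩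

theorem movePendant_adj_of_ne {G : SimpleGraph V} {v u x y : V} (hx : x ≠ v) (hy : y ≠ v) :
    (G.movePendant v u).Adj x y ↔ G.Adj x y := by
  simp [movePendant, hx, hy]

/-- A pendant vertex is irrelevant for `K_{2,t}`-minors, since `K_{2,t}` has minimum degree at
least two: it can be removed from its branch set. -/
theorem K2MinorFree.movePendant {t : ℕ} (ht : 2 ≤ t) {G : SimpleGraph V} (hG : G.K2MinorFree t)
    (v u : V) : (G.movePendant v u).K2MinorFree t := by
  refine k2MinorFree_of_forall_not_isBranchFamily fun B hB => ?_
  have key : ∀ a, v ∈ B a → u ∈ B a ∧ u ≠ v := by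
    intro a hva
    by_cases hsing : ∀ x ∈ B a, x = v
    · obtain ⟨b, c, hbc, hab, hac⟩ := exists_two_adj_completeBipartiteGraph ht a
      obtain ⟨x, hx, y, hy, hxy⟩ := hB.exists_adj a b hab
      obtain ⟨x', hx', y', hy', hxy'⟩ := hB.exists_adj a c hac
      rw [hsing x hx, movePendant_adj_left] at hxy
      rw [hsing x' hx', movePendant_adj_left] at hxy'
      rw [hxy.2] at hy
      rw [hxy'.2] at hy'
      exact absurd (hB.disjoint _ _ _ hy hy') hbc
    · by_contra hu
      refine hsing (((induce_connected_iff_forall_closed _ _).1 (hB.connected a)).2 (· = v)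
        ⟨v, hva, rfl⟩ ?_)
      rintro x hx y hy hxy rfl
      obtain ⟨h1, rfl⟩ := (movePendant_adj_left _).1 hxy
      exact absurd ⟨hy, h1⟩ hu
  refine hG.not_isBranchFamily (fun a => B a \ {v}) ⟨fun a => ?_, ?_, fun a b hab => ?_⟩
  · obtain ⟨⟨x, hx⟩, h⟩ := (induce_connected_iff_forall_closed _ _).1 (hB.connected a)
    refine (induce_connected_iff_forall_closed _ _).2 ⟨?_, fun P ⟨z, hz, hPz⟩ hP y hy => ?_⟩
    · by_cases hxv : x = v
      · subst hxv
        exact ⟨u, (key a hx).1, (key a hx).2⟩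
      · exact ⟨x, hx, hxv⟩
    · have := h (fun w => (w ≠ v → P w) ∧ (w = v → P u))
        ⟨z, hz.1, fun _ => hPz, fun h => absurd h hz.2⟩ ?_ y hy.1
      · exact this.1 hy.2
      · rintro p hp q hq hpq ⟨h1, h2⟩
        by_cases hpv : p = v
        · subst hpv
          obtain ⟨hu, rfl⟩ := (movePendant_adj_left _).1 hpq
          exact ⟨fun _ => h2 rfl, fun h => absurd h hu⟩
        · by_cases hqv : q = v
          · subst hqv
            obtain ⟨hu, rfl⟩ := (movePendant_adj_left _).1 hpq.symm
            exact ⟨fun h => absurd rfl h, fun _ => h1 hpv⟩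
          · exact ⟨fun _ => hP p ⟨hp, hpv⟩ q ⟨hq, hqv⟩ ((movePendant_adj_of_ne hpv hqv).1 hpq)
              (h1 hpv), fun h => absurd h hqv⟩
  · exact fun a b x hx hx' => hB.disjoint a b x hx.1 hx'.1
  · obtain ⟨x, hx, y, hy, hxy⟩ := hB.exists_adj a b hab
    have hxv : x ≠ v := by
      rintro rfl
      obtain ⟨_, rfl⟩ := (movePendant_adj_left _).1 hxy
      exact hab.ne (hB.disjoint _ _ _ (key a hx).1 hy)
    have hyv : y ≠ v := by
      rintro rfl
      obtain ⟨_, rfl⟩ := (movePendant_adj_left _).1 hxy.symm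
      exact hab.ne (hB.disjoint _ _ _ hx (key b hy).1)
    exact ⟨x, ⟨hx, hxv⟩, y, ⟨hy, hyv⟩, (movePendant_adj_of_ne hxv hyv).1 hxy⟩

/-- A graph all of whose edges contain one vertex `c` has no `K_{2,t}`-minor for `t ≥ 2`, because
`K_{2,t}` has two disjoint edges. -/
theorem k2MinorFree_of_forall_adj {t : ℕ} (ht : 2 ≤ t) {G : SimpleGraph V} (c : V)
    (h : ∀ x y, G.Adj x y → x = c ∨ y = c) : G.K2MinorFree t := by
  refine k2MinorFree_of_forall_not_isBranchFamily fun B hB => ?_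
  have key : ∀ i : Fin 2, ∀ j : Fin t, c ∈ B (Sum.inl i) ∨ c ∈ B (Sum.inr j) := by
    intro i j
    obtain ⟨x, hx, y, hy, hxy⟩ := hB.exists_adj (Sum.inl i) (Sum.inr j) (by simp)
    rcases h x y hxy with rfl | rfl
    · exact Or.inl hx
    · exact Or.inr hy
  rcases key 0 ⟨0, by omega⟩ with h1 | h1 <;> rcases key 1 ⟨1, by omega⟩ with h2 | h2 <;>
    · have := hB.disjoint _ _ _ h1 h2
      simp at this

/-- `K_{2,t}`-minor-free graphs have no `K_{2,t}` subgraph. -/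
theorem K2MinorFree.card_commonNeighbors_lt {t : ℕ} {G : SimpleGraph V} (hG : G.K2MinorFree t)
    {u v : V} (huv : u ≠ v) (s : Finset V) (hs : ∀ w ∈ s, G.Adj u w ∧ G.Adj v w) : #s < t := by
  by_contra! hts
  obtain ⟨s', hs', hcard⟩ := exists_subset_card_eq hts
  let e := s'.equivFinOfCardEq hcard
  let g : Fin 2 ⊕ Fin t → V := Sum.elim ![u, v] (fun j => (e.symm j : V))
  have hadj : ∀ (i : Fin 2) (j : Fin t), G.Adj (g (Sum.inl i)) (g (Sum.inr j)) := by
    intro i j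
    have := hs _ (hs' (e.symm j).2)
    fin_cases i
    · exact this.1
    · exact this.2
  have hinj : Function.Injective g := by
    refine Function.Injective.sumElim ?_ ?_ fun i j => (hadj i j).ne
    · intro i j hij
      fin_cases i <;> fin_cases j <;> simp_all
    · exact Subtype.val_injective.comp e.symm.injective
  refine hG.not_isBranchFamily (fun a => {g a}) ⟨fun a => ?_, ?_, ?_⟩
  · refine (induce_connected_iff_forall_closed _ _).2 ⟨⟨_, rfl⟩, ?_⟩
    rintro P ⟨_, rfl, hP⟩ _ _ rfl
    exact hP
  · rintro a b x rfl hx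
    exact hinj hx
  · rintro (a | a) (b | b) hab
    · simp at hab
    · exact ⟨_, rfl, _, rfl, hadj a b⟩
    · exact ⟨_, rfl, _, rfl, (hadj b a).symm⟩
    · simp at hab

/-- The graph obtained from `G` by contracting the edge `uv` to `u`, with `v` kept as an isolated
vertex. -/
def contractOnto (G : SimpleGraph V) (u v : V) : SimpleGraph V where
  Adj x y := x ≠ v ∧ y ≠ v ∧ x ≠ y ∧
    (G.Adj x y ∨ (x = u ∧ G.Adj v y) ∨ (y = u ∧ G.Adj v x))
  symm := ⟨fun x y ⟨h1, h2, h3, h4⟩ => ⟨h2, h1, h3.symm, by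
    rcases h4 with h | h | h
    · exact Or.inl h.symm
    · exact Or.inr (Or.inr h)
    · exact Or.inr (Or.inl h)⟩⟩
  loopless := ⟨fun x h => h.2.2.1 rfl⟩

theorem K2MinorFree.contractOnto {t : ℕ} (ht : 2 ≤ t) {G : SimpleGraph V} (hG : G.K2MinorFree t)
    {u v : V} (huv : G.Adj u v) : (G.contractOnto u v).K2MinorFree t := by
  refine k2MinorFree_of_forall_not_isBranchFamily fun B hB => ?_
  have hv : ∀ a, v ∉ B a := by
    intro a hva
    have hsing : ∀ x ∈ B a, x = v :=
      ((induce_connected_iff_forall_closed _ _).1 (hB.connected a)).2 (· = v) ⟨v, hva, rfl⟩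
        (by rintro x hx y hy hxy rfl; exact absurd rfl hxy.1)
    obtain ⟨b, -, -, hab, -⟩ := exists_two_adj_completeBipartiteGraph ht a
    obtain ⟨x, hx, y, -, hxy⟩ := hB.exists_adj a b hab
    exact hxy.1 (hsing x hx)
  let B' : Fin 2 ⊕ Fin t → Set V := fun a => {x | x ∈ B a ∨ (x = v ∧ u ∈ B a)}
  have hBB' : ∀ a x, x ∈ B a → x ∈ B' a := fun a x hx => Or.inl hx
  refine hG.not_isBranchFamily B' ⟨fun a => ?_, ?_, fun a b hab => ?_⟩
  · obtain ⟨⟨x, hx⟩, h⟩ := (induce_connected_iff_forall_closed _ _).1 (hB.connected a)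
    refine (induce_connected_iff_forall_closed _ _).2 ⟨⟨x, Or.inl hx⟩,
      fun P ⟨z, hz, hPz⟩ hP y hy => ?_⟩
    have huv' : u ∈ B a → (P u ↔ P v) := fun hu =>
      ⟨hP u (Or.inl hu) v (Or.inr ⟨rfl, hu⟩) huv, hP v (Or.inr ⟨rfl, hu⟩) u (Or.inl hu) huv.symm⟩
    have hall : ∀ y ∈ B a, P y := by
      refine h P ?_ ?_
      · rcases hz with hz | ⟨rfl, hu⟩
        · exact ⟨z, hz, hPz⟩
        · exact ⟨u, hu, (huv' hu).2 hPz⟩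
      · rintro p hp q hq ⟨h1, h2, h3, h4 | ⟨rfl, h4⟩ | ⟨rfl, h4⟩⟩ hPp
        · exact hP p (Or.inl hp) q (Or.inl hq) h4 hPp
        · exact hP v (Or.inr ⟨rfl, hp⟩) q (Or.inl hq) h4 ((huv' hp).1 hPp)
        · exact (huv' hq).2 (hP p (Or.inl hp) v (Or.inr ⟨rfl, hq⟩) h4.symm hPp)
    rcases hy with hy | ⟨rfl, hu⟩
    · exact hall y hy
    · exact (huv' hu).1 (hall u hu)
  · rintro a b x (hx | ⟨rfl, hx⟩) (hy | ⟨hxy, hy⟩)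
    · exact hB.disjoint _ _ _ hx hy
    · exact absurd (hxy ▸ hx) (hv a)
    · exact absurd hy (hv b)
    · exact hB.disjoint _ _ _ hx hy
  · obtain ⟨x, hx, y, hy, h1, h2, h3, h4 | ⟨rfl, h4⟩ | ⟨rfl, h4⟩⟩ := hB.exists_adj a b hab
    · exact ⟨x, Or.inl hx, y, Or.inl hy, h4⟩
    · exact ⟨v, Or.inr ⟨rfl, hx⟩, y, Or.inl hy, h4⟩
    · exact ⟨x, Or.inl hx, v, Or.inr ⟨rfl, hy⟩, h4.symm⟩

end Models

/-! ### The number of edges of a `K_{2,t}`-minor-free graph -/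

section EdgeCount

variable {V : Type*} [Fintype V]

open Classical in
/-- The pairs `(x, y)` with `x` adjacent to `y`; there are twice as many of them as edges. -/
noncomputable def adjPairs (G : SimpleGraph V) : Finset (V × V) :=
  univ.filter fun p => G.Adj p.1 p.2

theorem mem_adjPairs {G : SimpleGraph V} {p : V × V} : p ∈ G.adjPairs ↔ G.Adj p.1 p.2 := by
  simp [adjPairs]

variable [DecidableEq V]

/-- Contracting an edge `uv` whose ends have fewer than `t` common neighbours loses at most `t`
edges. -/
theorem card_adjPairs_le_contractOnto {t : ℕ} {G : SimpleGraph V} {u v : V} (huv : G.Adj u v)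
    (s : Finset V) (hs : ∀ w, G.Adj u w → G.Adj v w → w ∈ s) (hst : #s < t) :
    #G.adjPairs ≤ #(G.contractOnto u v).adjPairs + 2 * t := by
  let φ : V → V := fun w => if w = v then u else w
  -- the edges at `v` that are lost: the edge `uv` and the edges to the common neighbours
  let bad : Finset (V × V) :=
    (insert u s).image (fun w => (v, w)) ∪ (insert u s).image (fun w => (w, v))
  have hbad : #bad ≤ 2 * t := by
    have h1 : #(insert u s) ≤ t := (card_insert_le _ _).trans hst
    calc #bad ≤ _ := card_union_le _ _
      _ ≤ #(insert u s) + #(insert u s) := add_le_add card_image_le card_image_le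
      _ ≤ 2 * t := by omega
  have hmem : ∀ a b, G.Adj a b → (a, b) ∉ bad →
      (a = v → b ≠ u ∧ ¬ G.Adj u b) ∧ (b = v → a ≠ u ∧ ¬ G.Adj u a) := by
    intro a b hab hb
    simp only [bad, mem_union, mem_image, mem_insert, Prod.mk.injEq, not_or, not_exists,
      not_and] at hb
    refine ⟨?_, ?_⟩
    · rintro rfl
      exact ⟨fun h => hb.1 b (Or.inl h) rfl rfl, fun h => hb.1 b (Or.inr (hs b h hab)) rfl rfl⟩
    · rintro rfl
      exact ⟨fun h => hb.2 a (Or.inl h) rfl rfl, fun h => hb.2 a (Or.inr (hs a h hab.symm)) rfl rfl⟩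
  have hcard : #(G.adjPairs \ bad) ≤ #(G.contractOnto u v).adjPairs := by
    refine card_le_card_of_injOn (fun p => (φ p.1, φ p.2)) ?_ ?_
    · rintro ⟨a, b⟩ hp
      simp only [coe_sdiff, Set.mem_sdiff, mem_coe, mem_adjPairs] at hp ⊢
      obtain ⟨hab, hb⟩ := hp
      have h := hmem a b hab hb
      have huv' := huv.ne
      have hab' := hab.ne
      have hab2 := hab.symm
      simp only [contractOnto, φ]
      split_ifs with h1 h2 h2
      · exact absurd (h1.trans h2.symm) hab'
      · subst h1; grind
      · subst h2; grind
      · grind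
    · rintro ⟨a, b⟩ hp ⟨a', b'⟩ hp' heq
      simp only [coe_sdiff, Set.mem_sdiff, mem_coe, mem_adjPairs] at hp hp'
      have h := hmem a b hp.1 hp.2
      have h' := hmem a' b' hp'.1 hp'.2
      have e1 := hp.1
      have e2 := hp'.1
      have e3 := e1.symm
      have e4 := e2.symm
      have n1 := e1.ne
      have n2 := e2.ne
      have n3 := huv.ne
      simp only [φ, Prod.mk.injEq] at heq ⊢
      obtain ⟨q1, q2⟩ := heq
      split_ifs at q1 q2 <;> grind
  have := card_le_card_sdiff_add_card (s := G.adjPairs) (t := bad)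
  omega

/-- A `K_{2,t}`-minor-free graph with all edges inside `s` has at most `t|s|` edges. An edge in a
graph without a `K_{2,t}` subgraph lies in fewer than `t` triangles, so contracting it removes one
vertex and at most `t` edges. -/
theorem K2MinorFree.card_adjPairs_le {t : ℕ} (ht : 2 ≤ t) (s : Finset V) :
    ∀ G : SimpleGraph V, G.K2MinorFree t → (∀ x y, G.Adj x y → x ∈ s) →
      #G.adjPairs ≤ 2 * t * #s := by
  induction s using Finset.strongInduction with
  | H s ih =>
  intro G hG hs
  by_cases hE : ∃ u v, G.Adj u v
  · obtain ⟨u, v, huv⟩ := hE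
    classical
    let c : Finset V := univ.filter fun w => G.Adj u w ∧ G.Adj v w
    have hc : #c < t := hG.card_commonNeighbors_lt huv.ne c (by simp [c])
    have h1 := card_adjPairs_le_contractOnto huv c (by simp +contextual [c]) hc
    have hvs : v ∈ s := hs v u huv.symm
    have h2 := ih (s.erase v) (erase_ssubset hvs) _ (hG.contractOnto ht huv) (by
      rintro x y ⟨hx, hy, hxy, h | ⟨rfl, h⟩ | ⟨rfl, h⟩⟩
      · exact mem_erase.2 ⟨hx, hs _ _ h⟩
      · exact mem_erase.2 ⟨hx, hs _ _ huv⟩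
      · exact mem_erase.2 ⟨hx, hs _ _ h.symm⟩)
    have h3 : #s = #(s.erase v) + 1 := (card_erase_add_one hvs).symm
    rw [h3]
    linarith
  · have : G.adjPairs = ∅ := by
      ext p
      simpa [mem_adjPairs] using fun h => hE ⟨_, _, h⟩
    simp [this]

end EdgeCount

/-! ### Extreme eigenvalues and Rayleigh quotients -/

section Spectrum

variable {V : Type*}

theorem realAdj_apply (G : SimpleGraph V) (v w : V) [Decidable (G.Adj v w)] :
    G.realAdj v w = if G.Adj v w then 1 else 0 := by
  classical
  simp only [realAdj, adjMatrix_apply]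
  congr

theorem realAdj_nonneg (G : SimpleGraph V) (v w : V) : 0 ≤ G.realAdj v w := by
  classical
  rw [realAdj_apply]
  split_ifs <;> norm_num

theorem realAdj_le_one (G : SimpleGraph V) (v w : V) : G.realAdj v w ≤ 1 := by
  classical
  rw [realAdj_apply]
  split_ifs <;> norm_num

theorem realAdj_self (G : SimpleGraph V) (v : V) : G.realAdj v v = 0 := by
  classical
  simp [realAdj_apply]

theorem realAdj_comm (G : SimpleGraph V) (v w : V) : G.realAdj v w = G.realAdj w v := by
  classical
  simp [realAdj_apply, G.adj_comm v w]

theorem isHermitian_realAdj (G : SimpleGraph V) : G.realAdj.IsHermitian := by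
  ext v w
  simp [realAdj_comm G v w]

variable [Fintype V] [DecidableEq V]

/-- The smallest eigenvalue of the adjacency matrix of a finite nonempty graph. -/
noncomputable def lambdaMin (G : SimpleGraph V) : ℝ :=
  sInf (spectrum ℝ G.realAdj)

theorem finite_spectrum_realAdj (G : SimpleGraph V) : (spectrum ℝ G.realAdj).Finite :=
  Matrix.finite_real_spectrum

theorem spread_eq (G : SimpleGraph V) : G.spread = G.lambdaOne - G.lambdaMin :=
  Real.diam_eq G.finite_spectrum_realAdj.isBounded

/-- The matrix `λ₁ - A` is positive semidefinite. -/
theorem posSemidef_lambdaOne_sub (G : SimpleGraph V) :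
    (algebraMap ℝ (Matrix V V ℝ) G.lambdaOne - G.realAdj).PosSemidef := by
  refine posSemidef_iff_isHermitian_and_spectrum_nonneg.2 ⟨?_, ?_⟩
  · refine IsHermitian.sub ?_ G.isHermitian_realAdj
    ext i j
    simp [algebraMap_matrix_apply, eq_comm]
  · rw [← spectrum.singleton_sub_eq]
    rintro _ ⟨a, rfl, b, hb, rfl⟩
    exact sub_nonneg.2 (le_csSup G.finite_spectrum_realAdj.bddAbove hb)

theorem posSemidef_sub_lambdaMin (G : SimpleGraph V) :
    (G.realAdj - algebraMap ℝ (Matrix V V ℝ) G.lambdaMin).PosSemidef := by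
  refine posSemidef_iff_isHermitian_and_spectrum_nonneg.2 ⟨?_, ?_⟩
  · refine IsHermitian.sub G.isHermitian_realAdj ?_
    ext i j
    simp [algebraMap_matrix_apply, eq_comm]
  · rw [← spectrum.sub_singleton_eq]
    rintro _ ⟨b, hb, a, rfl, rfl⟩
    exact sub_nonneg.2 (csInf_le G.finite_spectrum_realAdj.bddBelow hb)

theorem dotProduct_realAdj_mulVec_le (G : SimpleGraph V) (x : V → ℝ) :
    x ⬝ᵥ G.realAdj *ᵥ x ≤ G.lambdaOne * (x ⬝ᵥ x) := by
  have := G.posSemidef_lambdaOne_sub.dotProduct_mulVec_nonneg x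
  simpa [sub_mulVec, Algebra.algebraMap_eq_smul_one, smul_mulVec] using this

theorem le_dotProduct_realAdj_mulVec (G : SimpleGraph V) (x : V → ℝ) :
    G.lambdaMin * (x ⬝ᵥ x) ≤ x ⬝ᵥ G.realAdj *ᵥ x := by
  have := G.posSemidef_sub_lambdaMin.dotProduct_mulVec_nonneg x
  simpa [sub_mulVec, Algebra.algebraMap_eq_smul_one, smul_mulVec] using this

/-- A vector attaining the maximum of the Rayleigh quotient is an eigenvector. -/
theorem mulVec_eq_of_lambdaOne_le (G : SimpleGraph V) {x : V → ℝ}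
    (h : G.lambdaOne * (x ⬝ᵥ x) ≤ x ⬝ᵥ G.realAdj *ᵥ x) :
    G.realAdj *ᵥ x = G.lambdaOne • x := by
  have h0 := (G.posSemidef_lambdaOne_sub.dotProduct_mulVec_zero_iff x).1 (by
    have := G.dotProduct_realAdj_mulVec_le x
    simp only [star_trivial, sub_mulVec, Algebra.algebraMap_eq_smul_one, smul_mulVec, one_mulVec,
      dotProduct_sub, dotProduct_smul, smul_eq_mul]
    linarith)
  rw [sub_mulVec, Algebra.algebraMap_eq_smul_one, smul_mulVec, one_mulVec] at h0
  exact (sub_eq_zero.1 h0).symm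

/-- An eigenvector can be scaled so that `1` is an entry of largest absolute value. -/
theorem exists_normalized_eigenvector (G : SimpleGraph V) {c : ℝ}
    (hc : c ∈ spectrum ℝ G.realAdj) :
    ∃ (x : V → ℝ) (u : V), G.realAdj *ᵥ x = c • x ∧ (∀ v, |x v| ≤ 1) ∧ x u = 1 := by
  rw [← Matrix.spectrum_toLin', ← Module.End.hasEigenvalue_iff_mem_spectrum] at hc
  obtain ⟨y, hy⟩ := hc.exists_hasEigenvector
  have hAy : G.realAdj *ᵥ y = c • y := by simpa using hy.apply_eq_smul
  obtain ⟨w, hw⟩ : ∃ w, y w ≠ 0 := by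
    by_contra! h
    exact hy.2 (funext h)
  obtain ⟨u, -, hu⟩ := exists_max_image univ (fun v => |y v|) ⟨w, mem_univ w⟩
  have hyu : y u ≠ 0 := fun h => by
    have := hu w (mem_univ w)
    rw [h, abs_zero] at this
    exact hw (abs_nonpos_iff.1 this)
  refine ⟨(y u)⁻¹ • y, u, ?_, fun v => ?_, by simp [hyu]⟩
  · rw [mulVec_smul, hAy, smul_comm]
  · rw [Pi.smul_apply, smul_eq_mul, abs_mul, abs_inv, inv_mul_le_iff₀ (abs_pos.2 hyu), mul_one]
    exact hu v (mem_univ v)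

variable [Nonempty V]

theorem spectrum_realAdj_nonempty (G : SimpleGraph V) : (spectrum ℝ G.realAdj).Nonempty := by
  obtain ⟨v⟩ := ‹Nonempty V›
  exact ⟨_, G.isHermitian_realAdj.eigenvalues_mem_spectrum_real v⟩

theorem lambdaOne_mem_spectrum (G : SimpleGraph V) : G.lambdaOne ∈ spectrum ℝ G.realAdj :=
  G.spectrum_realAdj_nonempty.csSup_mem G.finite_spectrum_realAdj

theorem lambdaMin_mem_spectrum (G : SimpleGraph V) : G.lambdaMin ∈ spectrum ℝ G.realAdj :=
  G.spectrum_realAdj_nonempty.csInf_mem G.finite_spectrum_realAdj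

end Spectrum

/-! ### Changing one entry of a test vector -/

section Rayleigh

variable {V : Type*} [Fintype V]

theorem dotProduct_mulVec_eq_sum (A : Matrix V V ℝ) (x : V → ℝ) :
    x ⬝ᵥ A *ᵥ x = ∑ v, ∑ w, x v * (A v w * x w) := by
  simp only [dotProduct, mulVec, mul_sum]

theorem abs_dotProduct_realAdj_mulVec_le (G : SimpleGraph V) (x : V → ℝ) :
    |x ⬝ᵥ G.realAdj *ᵥ x| ≤ |x| ⬝ᵥ G.realAdj *ᵥ |x| := by
  rw [dotProduct_mulVec_eq_sum, dotProduct_mulVec_eq_sum]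
  refine (abs_sum_le_sum_abs _ _).trans (sum_le_sum fun v _ => ?_)
  refine (abs_sum_le_sum_abs _ _).trans (sum_le_sum fun w _ => ?_)
  rw [abs_mul, abs_mul, abs_of_nonneg (G.realAdj_nonneg v w)]
  rfl

theorem abs_dotProduct_abs_self (x : V → ℝ) : |x| ⬝ᵥ |x| = x ⬝ᵥ x := by
  simp [dotProduct]

theorem dotProduct_self_pos_of_apply_eq_one {x : V → ℝ} {u : V} (hu : x u = 1) : 0 < x ⬝ᵥ x := by
  refine lt_of_lt_of_le (b := x u * x u) (by simp [hu]) ?_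
  exact single_le_sum (f := fun v => x v * x v) (fun v _ => mul_self_nonneg _) (mem_univ u)

variable [DecidableEq V]

theorem neg_lambdaMin_le_lambdaOne [Nonempty V] (G : SimpleGraph V) :
    -G.lambdaMin ≤ G.lambdaOne := by
  obtain ⟨z, w, hz, -, hw⟩ := G.exists_normalized_eigenvector G.lambdaMin_mem_spectrum
  have h1 := G.abs_dotProduct_realAdj_mulVec_le z
  have h2 := G.dotProduct_realAdj_mulVec_le |z|
  rw [hz, dotProduct_smul, smul_eq_mul] at h1
  rw [abs_dotProduct_abs_self] at h2
  refine le_of_mul_le_mul_right ?_ (dotProduct_self_pos_of_apply_eq_one hw)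
  linarith [neg_abs_le (G.lambdaMin * (z ⬝ᵥ z))]

theorem dotProduct_self_update (x : V → ℝ) (v : V) (s : ℝ) :
    Function.update x v s ⬝ᵥ Function.update x v s = x ⬝ᵥ x - x v ^ 2 + s ^ 2 := by
  simp only [dotProduct]
  rw [← add_sum_erase univ _ (mem_univ v), ← add_sum_erase univ (fun i => x i * x i) (mem_univ v),
    sum_congr rfl (g := fun i => x i * x i) fun i hi => by simp [ne_of_mem_erase hi]]
  simp only [Function.update_self]
  ring

theorem realAdj_mulVec_update_self (G : SimpleGraph V) (x : V → ℝ) (v : V) (s : ℝ) :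
    (G.realAdj *ᵥ Function.update x v s) v = (G.realAdj *ᵥ x) v := by
  simp only [mulVec, dotProduct]
  refine sum_congr rfl fun w _ => ?_
  by_cases h : w = v
  · subst h
    simp [realAdj_self]
  · simp [h]

/-- The entry at `v` contributes linearly to the quadratic form of an adjacency matrix. -/
theorem dotProduct_realAdj_mulVec_update (G : SimpleGraph V) (x : V → ℝ) (v : V) (s : ℝ) :
    Function.update x v s ⬝ᵥ G.realAdj *ᵥ Function.update x v s =
      Function.update x v 0 ⬝ᵥ G.realAdj *ᵥ Function.update x v 0 + 2 * s * (G.realAdj *ᵥ x) v := by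
  have hx : Function.update x v s = Function.update x v 0 + s • Pi.single v 1 := by
    ext w
    by_cases h : w = v
    · subst h; simp
    · simp [h]
  have h1 : (G.realAdj *ᵥ Function.update x v 0) v = (G.realAdj *ᵥ x) v :=
    G.realAdj_mulVec_update_self x v 0
  have h2 : Function.update x v 0 ⬝ᵥ G.realAdj *ᵥ Pi.single v 1 =
      (G.realAdj *ᵥ Function.update x v 0) v := by
    rw [mulVec_single_one, dotProduct_comm]
    simp only [mulVec, dotProduct, col_apply]
    exact sum_congr rfl fun w _ => by rw [realAdj_comm]
  rw [hx, mulVec_add, mulVec_smul, dotProduct_add, add_dotProduct, add_dotProduct,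
    dotProduct_smul, smul_dotProduct, smul_dotProduct, dotProduct_smul, h2,
    single_one_dotProduct, single_one_dotProduct, h1, mulVec_single_one]
  simp [realAdj_self]
  ring

theorem movePendant_mulVec_apply {G : SimpleGraph V} {v u : V} (huv : u ≠ v) (x : V → ℝ) :
    ((G.movePendant v u).realAdj *ᵥ x) v = x u := by
  classical
  simp [mulVec, dotProduct, realAdj_apply, movePendant_adj_left, huv]

theorem dotProduct_movePendant_update_zero (G : SimpleGraph V) (v u : V) (x : V → ℝ) :
    Function.update x v 0 ⬝ᵥ (G.movePendant v u).realAdj *ᵥ Function.update x v 0 =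
      Function.update x v 0 ⬝ᵥ G.realAdj *ᵥ Function.update x v 0 := by
  classical
  rw [dotProduct_mulVec_eq_sum, dotProduct_mulVec_eq_sum]
  refine sum_congr rfl fun a _ => sum_congr rfl fun b _ => ?_
  by_cases ha : a = v
  · subst ha; simp
  by_cases hb : b = v
  · subst hb; simp
  rw [realAdj_apply, realAdj_apply]
  simp [movePendant_adj_of_ne ha hb]

/-- The excess of the Rayleigh quotient over the eigenvalue `c` when `v` becomes a pendant
neighbour of `u` and the entry at `v` becomes `1/c`, the entry it would have in an eigenvector for
`c` of the new graph. -/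
theorem dotProduct_movePendant_update_sub {G : SimpleGraph V} {v u : V} (huv : u ≠ v) {x : V → ℝ}
    {c : ℝ} (hc : c ≠ 0) (hx : G.realAdj *ᵥ x = c • x) (hu : x u = 1) :
    Function.update x v c⁻¹ ⬝ᵥ (G.movePendant v u).realAdj *ᵥ Function.update x v c⁻¹ -
      c * (Function.update x v c⁻¹ ⬝ᵥ Function.update x v c⁻¹) = (1 - (c * x v) ^ 2) / c := by
  have h1 := dotProduct_realAdj_mulVec_update G x v (x v)
  rw [Function.update_eq_self, hx, dotProduct_smul] at h1
  simp only [smul_eq_mul, Pi.smul_apply] at h1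
  rw [dotProduct_realAdj_mulVec_update, dotProduct_movePendant_update_zero,
    movePendant_mulVec_apply huv, hu, dotProduct_self_update, eq_sub_of_add_eq h1.symm]
  field_simp
  ring

/-- Turning `v` into a pendant neighbour of `u` increases the spread if the entries of the extremal
eigenvectors at `v` are small. -/
theorem spread_lt_spread_movePendant {G : SimpleGraph V} {v u : V} (huv : u ≠ v) {x z : V → ℝ}
    (hx : G.realAdj *ᵥ x = G.lambdaOne • x) (hz : G.realAdj *ᵥ z = G.lambdaMin • z)
    (hxu : x u = 1) (hzu : z u = 1) (hpos : 0 < G.lambdaOne) (hneg : G.lambdaMin < 0)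
    (hxv : |G.lambdaOne * x v| < 1) (hzv : |G.lambdaMin * z v| < 1) :
    G.spread < (G.movePendant v u).spread := by
  have h1 := dotProduct_movePendant_update_sub huv hpos.ne' hx hxu
  have h2 := dotProduct_movePendant_update_sub huv hneg.ne hz hzu
  have h3 := (G.movePendant v u).dotProduct_realAdj_mulVec_le (Function.update x v G.lambdaOne⁻¹)
  have h4 := (G.movePendant v u).le_dotProduct_realAdj_mulVec (Function.update z v G.lambdaMin⁻¹)
  have h5 : 0 < (1 - (G.lambdaOne * x v) ^ 2) / G.lambdaOne :=
    div_pos (sub_pos.2 ((sq_lt_one_iff_abs_lt_one _).2 hxv)) hpos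
  have h6 : (1 - (G.lambdaMin * z v) ^ 2) / G.lambdaMin < 0 :=
    div_neg_of_pos_of_neg (sub_pos.2 ((sq_lt_one_iff_abs_lt_one _).2 hzv)) hneg
  have h7 : G.lambdaOne < (G.movePendant v u).lambdaOne := by
    refine lt_of_mul_lt_mul_right (a := Function.update x v G.lambdaOne⁻¹ ⬝ᵥ
      Function.update x v G.lambdaOne⁻¹) ?_ (dotProduct_self_star_nonneg _)
    linarith
  have h8 : (G.movePendant v u).lambdaMin < G.lambdaMin := by
    refine lt_of_mul_lt_mul_right (a := Function.update z v G.lambdaMin⁻¹ ⬝ᵥ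
      Function.update z v G.lambdaMin⁻¹) ?_ (dotProduct_self_star_nonneg _)
    linarith
  rw [spread_eq, spread_eq]
  linarith

/-- The star with centre `c`. -/
def starAt (c : V) : SimpleGraph V where
  Adj x y := x ≠ y ∧ (x = c ∨ y = c)
  symm := ⟨fun _ _ h => ⟨h.1.symm, h.2.symm⟩⟩
  loopless := ⟨fun _ h => h.1 rfl⟩

theorem starAt_test (c : V) (s : ℝ) :
    Function.update (fun _ => 1) c s ⬝ᵥ (starAt c).realAdj *ᵥ Function.update (fun _ => 1) c s =
      2 * s * (Fintype.card V - 1) := by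
  classical
  have h0 : Function.update (fun _ => (1 : ℝ)) c 0 ⬝ᵥ (starAt c).realAdj *ᵥ
      Function.update (fun _ => 1) c 0 = 0 := by
    rw [dotProduct_mulVec_eq_sum]
    refine sum_eq_zero fun a _ => sum_eq_zero fun b _ => ?_
    by_cases ha : a = c
    · subst ha; simp
    by_cases hb : b = c
    · subst hb; simp
    rw [realAdj_apply]
    simp [starAt, ha, hb]
  have h1 : ((starAt c).realAdj *ᵥ (fun _ => 1)) c = Fintype.card V - 1 := by
    simp only [mulVec, dotProduct, mul_one]
    rw [← add_sum_erase univ _ (mem_univ c), realAdj_self,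
      sum_congr rfl (g := fun _ => (1 : ℝ)) fun i hi => by
        simp [realAdj_apply, starAt, (ne_of_mem_erase hi).symm]]
    have : 1 ≤ Fintype.card V := Fintype.card_pos_iff.2 ⟨c⟩
    simp [card_erase_of_mem, card_univ, this]
  rw [dotProduct_realAdj_mulVec_update, h0, h1, zero_add]

/-- The spread of a star on `m² + 1` vertices is at least `2m`. -/
theorem two_mul_le_spread_starAt (c : V) {m : ℝ} (hm : 0 < m)
    (hcard : (Fintype.card V : ℝ) = m ^ 2 + 1) :
    2 * m ≤ (starAt c).spread := by
  have hnorm : ∀ s : ℝ, s ^ 2 = m ^ 2 → Function.update (fun _ : V => (1 : ℝ)) c s ⬝ᵥ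
      Function.update (fun _ => 1) c s = 2 * m ^ 2 := by
    intro s hs
    rw [dotProduct_self_update, hs]
    simp only [dotProduct, mul_one, sum_const, card_univ, nsmul_eq_mul, hcard]
    ring
  have h1 := (starAt c).dotProduct_realAdj_mulVec_le (Function.update (fun _ => 1) c m)
  have h2 := (starAt c).le_dotProduct_realAdj_mulVec (Function.update (fun _ => 1) c (-m))
  rw [starAt_test, hnorm _ (by ring), hcard] at h1 h2
  have h3 : m ≤ (starAt c).lambdaOne := by
    refine le_of_mul_le_mul_right (a := 2 * m ^ 2) ?_ (by positivity)
    linarith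
  have h4 : (starAt c).lambdaMin ≤ -m := by
    refine le_of_mul_le_mul_right (a := 2 * m ^ 2) ?_ (by positivity)
    linarith
  rw [spread_eq]
  linarith

end Rayleigh

/-! ### Neighbour counts as sums of matrix entries -/

section Counting

variable {V : Type*} [Fintype V] {t : ℕ} {G : SimpleGraph V}

theorem K2MinorFree.sum_realAdj_mul_realAdj_le (hG : G.K2MinorFree t) {u v : V} (huv : u ≠ v) :
    ∑ w, G.realAdj u w * G.realAdj w v ≤ t := by
  classical
  have h1 : ∑ w, G.realAdj u w * G.realAdj w v =
      (#(univ.filter fun w => G.Adj u w ∧ G.Adj v w) : ℝ) := by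
    rw [card_filter, Nat.cast_sum]
    refine sum_congr rfl fun w _ => ?_
    rw [realAdj_comm G w v, realAdj_apply, realAdj_apply]
    by_cases h1 : G.Adj u w <;> by_cases h2 : G.Adj v w <;> simp [h1, h2]
  rw [h1]
  exact_mod_cast (hG.card_commonNeighbors_lt huv _ (by simp)).le

variable [DecidableEq V]

/-- The number of ordered adjacent pairs inside a vertex set `s` is at most `2t|s|`. -/
theorem K2MinorFree.sum_sum_realAdj_le (ht : 2 ≤ t) (hG : G.K2MinorFree t) (s : Finset V) :
    ∑ v ∈ s, ∑ w ∈ s, G.realAdj v w ≤ 2 * t * #s := by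
  classical
  let H : SimpleGraph V :=
    { Adj := fun x y => G.Adj x y ∧ x ∈ s ∧ y ∈ s
      symm := ⟨fun _ _ h => ⟨h.1.symm, h.2.2, h.2.1⟩⟩
      loopless := ⟨fun _ h => h.1.ne rfl⟩ }
  have h1 : #H.adjPairs ≤ 2 * t * #s :=
    K2MinorFree.card_adjPairs_le ht s H (hG.mono fun _ _ h => h.1) fun _ _ h => h.2.1
  have h2 : H.adjPairs = (s ×ˢ s).filter fun p => G.Adj p.1 p.2 := by
    ext p
    simp [mem_adjPairs, H, and_comm]
  have h3 : ∑ v ∈ s, ∑ w ∈ s, G.realAdj v w = (#H.adjPairs : ℝ) := by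
    rw [h2, card_filter, Nat.cast_sum]
    refine (sum_product' s s fun v w => G.realAdj v w).symm.trans ?_
    exact sum_congr rfl fun p _ => by rw [realAdj_apply]; simp
  rw [h3]
  exact_mod_cast h1

/-- The vertices different from `u` that are not adjacent to `u`. -/
noncomputable def nonNeighbors (G : SimpleGraph V) (u : V) : Finset V := by
  classical exact univ.filter fun w => w ≠ u ∧ ¬ G.Adj u w

theorem mem_nonNeighbors {u w : V} : w ∈ G.nonNeighbors u ↔ w ≠ u ∧ ¬ G.Adj u w := by
  simp [nonNeighbors]

/-- Every vertex is a neighbour of `u`, a non-neighbour of `u`, or `u` itself. -/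
theorem realAdj_add_ite_add_ite (u w : V) :
    G.realAdj w u + (if w ∈ G.nonNeighbors u then 1 else 0) + (if w = u then 1 else 0) = 1 := by
  classical
  rw [realAdj_comm, realAdj_apply]
  simp only [mem_nonNeighbors]
  by_cases h : w = u
  · subst h; simp
  · by_cases h' : G.Adj u w <;> simp [h, h']

theorem sum_realAdj_add_card_nonNeighbors (u : V) :
    ∑ w, G.realAdj u w + #(G.nonNeighbors u) + 1 = Fintype.card V := by
  have h := sum_congr (s₁ := univ) rfl fun w _ => G.realAdj_add_ite_add_ite u w
  simp only [sum_add_distrib, sum_ite_eq', mem_univ, if_true, sum_const, card_univ, nsmul_eq_mul,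
    mul_one, sum_boole, filter_univ_mem] at h
  rw [← h]
  simp only [realAdj_comm G u]

/-- The neighbours of `v` are `u`, non-neighbours of `u`, or common neighbours of `u` and `v`. -/
theorem K2MinorFree.sum_realAdj_le (hG : G.K2MinorFree t) {u v : V} (hvu : v ≠ u) :
    ∑ w, G.realAdj v w ≤ t + #(G.nonNeighbors u) + 1 := by
  have h : ∀ w, G.realAdj v w ≤ G.realAdj v w * G.realAdj w u +
      (if w ∈ G.nonNeighbors u then 1 else 0) + (if w = u then 1 else 0) := by
    intro w
    have h1 := G.realAdj_add_ite_add_ite u w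
    have h2 := G.realAdj_nonneg v w
    have h3 := G.realAdj_le_one v w
    have h4 : (0 : ℝ) ≤ (if w ∈ G.nonNeighbors u then 1 else 0) := by split_ifs <;> norm_num
    have h5 : (0 : ℝ) ≤ (if w = u then 1 else 0) := by split_ifs <;> norm_num
    nlinarith
  refine (sum_le_sum fun w _ => h w).trans ?_
  simp only [sum_add_distrib, sum_ite_eq', mem_univ, if_true, sum_boole, filter_univ_mem]
  linarith [hG.sum_realAdj_mul_realAdj_le hvu]

end Counting

/-! ### Entries of eigenvectors for large eigenvalues -/

section Subeigenvector

variable {V : Type*} [Fintype V]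

/-- A nonnegative vector `y` with largest entry `y u = 1` and `ρ y ≤ A y` entrywise. The entrywise
absolute value of a normalized eigenvector for `±ρ` is such a vector. -/
structure IsSubeigenvector (G : SimpleGraph V) (ρ : ℝ) (u : V) (y : V → ℝ) : Prop where
  nonneg : ∀ v, 0 ≤ y v
  le_one : ∀ v, y v ≤ 1
  apply_eq_one : y u = 1
  mul_le : ∀ v, ρ * y v ≤ ∑ w, G.realAdj v w * y w

theorem isSubeigenvector_abs {G : SimpleGraph V} {x : V → ℝ} {c : ℝ} {u : V}
    (hx : G.realAdj *ᵥ x = c • x) (hle : ∀ v, |x v| ≤ 1) (hu : x u = 1) :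
    G.IsSubeigenvector |c| u (fun v => |x v|) where
  nonneg v := abs_nonneg _
  le_one := hle
  apply_eq_one := by simp [hu]
  mul_le v := by
    have h := congrFun hx v
    rw [Pi.smul_apply, smul_eq_mul] at h
    rw [← abs_mul, ← h, mulVec, dotProduct]
    refine (abs_sum_le_sum_abs _ _).trans (sum_le_sum fun w _ => ?_)
    rw [abs_mul, abs_of_nonneg (G.realAdj_nonneg v w)]

namespace IsSubeigenvector

variable {G : SimpleGraph V} {ρ : ℝ} {u : V} {y : V → ℝ} {t : ℕ}

theorem sum_nonneg (h : G.IsSubeigenvector ρ u y) : 0 ≤ ∑ v, y v :=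
  Finset.sum_nonneg fun v _ => h.nonneg v

variable [DecidableEq V]

theorem mul_sum_le (h : G.IsSubeigenvector ρ u y) (ht : 2 ≤ t) (hG : G.K2MinorFree t) :
    ρ * ∑ v, y v ≤ 2 * t * Fintype.card V := by
  rw [mul_sum]
  calc ∑ v, ρ * y v ≤ ∑ v, ∑ w, G.realAdj v w := by
        refine sum_le_sum fun v _ => (h.mul_le v).trans (sum_le_sum fun w _ => ?_)
        exact mul_le_of_le_one_right (G.realAdj_nonneg v w) (h.le_one w)
    _ ≤ _ := hG.sum_sum_realAdj_le ht univ

/-- Counting walks of length two: those returning to `v` number `d(v)`, and at most `t` of them end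
at any other given vertex. -/
theorem sq_mul_le (h : G.IsSubeigenvector ρ u y) (hρ : 0 ≤ ρ) (hG : G.K2MinorFree t) (v : V) :
    ρ ^ 2 * y v ≤ (∑ w, G.realAdj v w) * y v + t * ∑ w, y w := by
  calc ρ ^ 2 * y v = ρ * (ρ * y v) := by ring
    _ ≤ ρ * ∑ w, G.realAdj v w * y w := mul_le_mul_of_nonneg_left (h.mul_le v) hρ
    _ = ∑ w, G.realAdj v w * (ρ * y w) := by
        rw [mul_sum]
        exact sum_congr rfl fun w _ => by ring
    _ ≤ ∑ w, G.realAdj v w * ∑ k, G.realAdj w k * y k :=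
        sum_le_sum fun w _ => mul_le_mul_of_nonneg_left (h.mul_le w) (G.realAdj_nonneg v w)
    _ = ∑ k, (∑ w, G.realAdj v w * G.realAdj w k) * y k := by
        simp only [mul_sum, sum_mul]
        rw [sum_comm]
        exact sum_congr rfl fun w _ => sum_congr rfl fun k _ => by ring
    _ ≤ ∑ k, ((if k = v then (∑ w, G.realAdj v w) * y k else 0) + t * y k) := by
        refine sum_le_sum fun k _ => ?_
        split_ifs with hk
        · refine le_add_of_le_of_nonneg (mul_le_mul_of_nonneg_right ?_ (h.nonneg k))
            (mul_nonneg t.cast_nonneg (h.nonneg k))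
          exact sum_le_sum fun w _ =>
            mul_le_of_le_one_right (G.realAdj_nonneg v w) (G.realAdj_le_one w k)
        · rw [zero_add]
          exact mul_le_mul_of_nonneg_right (hG.sum_realAdj_mul_realAdj_le (Ne.symm hk)) (h.nonneg k)
    _ = _ := by simp [sum_add_distrib, mul_sum]

theorem sq_le (h : G.IsSubeigenvector ρ u y) (hρ : 0 ≤ ρ) (hG : G.K2MinorFree t) :
    ρ ^ 2 ≤ (∑ w, G.realAdj u w) + t * ∑ w, y w := by
  simpa [h.apply_eq_one] using h.sq_mul_le hρ hG u

/-- If all entries away from `u` are at most `ε`, then the entry at a non-neighbour `v` of `u` is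
controlled by the entries at the other non-neighbours. -/
theorem mul_le_of_mem_nonNeighbors (h : G.IsSubeigenvector ρ u y) (hG : G.K2MinorFree t) {ε : ℝ}
    (hε : ∀ w ≠ u, y w ≤ ε) {v : V} (hv : v ∈ G.nonNeighbors u) :
    ρ * y v ≤ t * ε + ∑ w ∈ G.nonNeighbors u, G.realAdj v w * y w := by
  classical
  obtain ⟨hvu, hadj⟩ := mem_nonNeighbors.1 hv
  have hε0 : 0 ≤ ε := (h.nonneg v).trans (hε v hvu)
  have hpt : ∀ w, G.realAdj v w * y w ≤ G.realAdj v w * G.realAdj w u * ε +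
      (if w ∈ G.nonNeighbors u then G.realAdj v w * y w else 0) := by
    intro w
    have h1 : 0 ≤ G.realAdj v w * G.realAdj w u * ε :=
      mul_nonneg (mul_nonneg (G.realAdj_nonneg _ _) (G.realAdj_nonneg _ _)) hε0
    split_ifs with hw
    · linarith
    · by_cases hwu : w = u
      · subst hwu
        have hvw : ¬ G.Adj v w := fun h' => hadj h'.symm
        simp [realAdj_apply, hvw]
      · have huw : G.Adj u w := by
          by_contra hc
          exact hw (mem_nonNeighbors.2 ⟨hwu, hc⟩)
        rw [realAdj_apply G w u, if_pos huw.symm, mul_one, add_zero]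
        exact mul_le_mul_of_nonneg_left (hε w hwu) (G.realAdj_nonneg _ _)
  refine (h.mul_le v).trans ((sum_le_sum fun w _ => hpt w).trans ?_)
  rw [sum_add_distrib, ← sum_mul, sum_ite_mem, univ_inter]
  gcongr
  exact hG.sum_realAdj_mul_realAdj_le hvu

theorem mul_sum_nonNeighbors_le (h : G.IsSubeigenvector ρ u y) (ht : 2 ≤ t)
    (hG : G.K2MinorFree t) {ε : ℝ} (hε0 : 0 ≤ ε) (hε : ∀ w ≠ u, y w ≤ ε) :
    ρ * ∑ v ∈ G.nonNeighbors u, y v ≤ 3 * t * ε * #(G.nonNeighbors u) := by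
  rw [mul_sum]
  calc ∑ v ∈ G.nonNeighbors u, ρ * y v
      ≤ ∑ v ∈ G.nonNeighbors u, (t * ε + ∑ w ∈ G.nonNeighbors u, G.realAdj v w * ε) := by
        refine sum_le_sum fun v hv => (h.mul_le_of_mem_nonNeighbors hG hε hv).trans ?_
        gcongr with w hw
        · exact G.realAdj_nonneg v w
        · exact hε w (mem_nonNeighbors.1 hw).1
    _ = #(G.nonNeighbors u) * (t * ε) +
          (∑ v ∈ G.nonNeighbors u, ∑ w ∈ G.nonNeighbors u, G.realAdj v w) * ε := by
        simp only [sum_add_distrib, sum_const, nsmul_eq_mul, sum_mul]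
    _ ≤ #(G.nonNeighbors u) * (t * ε) + (2 * t * #(G.nonNeighbors u)) * ε := by
        gcongr
        exact hG.sum_sum_realAdj_le ht _
    _ = _ := by ring

/-- The entry at a non-neighbour of `u` is at most the bound from common neighbours plus the sum
over all non-neighbours. -/
theorem mul_le_add_sum_nonNeighbors (h : G.IsSubeigenvector ρ u y) (hG : G.K2MinorFree t) {ε : ℝ}
    (hε : ∀ w ≠ u, y w ≤ ε) {v : V} (hv : v ∈ G.nonNeighbors u) :
    ρ * y v ≤ t * ε + ∑ w ∈ G.nonNeighbors u, y w := by
  refine (h.mul_le_of_mem_nonNeighbors hG hε hv).trans ?_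
  gcongr with w hw
  exact mul_le_of_le_one_left (h.nonneg w) (G.realAdj_le_one v w)

variable {m : ℝ}

theorem sum_le (h : G.IsSubeigenvector ρ u y) (ht : 2 ≤ t) (hG : G.K2MinorFree t)
    (hcard : (Fintype.card V : ℝ) = m ^ 2 + 1) (hm : 1 ≤ m) {a : ℝ} (ha : 0 < a)
    (hρ : a * m ≤ ρ) : ∑ v, y v ≤ 4 * t * m / a := by
  have h1 := h.mul_sum_le ht hG
  have h2 := mul_le_mul_of_nonneg_right hρ h.sum_nonneg
  rw [hcard] at h1
  have ht0 : (0 : ℝ) ≤ t := t.cast_nonneg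
  rw [le_div_iff₀ ha]
  refine le_of_mul_le_mul_left ?_ (zero_lt_one.trans_le hm)
  have h3 : 2 * (t : ℝ) * (m ^ 2 + 1) ≤ 2 * t * (2 * m ^ 2) :=
    mul_le_mul_of_nonneg_left (by nlinarith) (by positivity)
  linarith

/-- If `ρ` is close to `m = √(n - 1)`, then `u` has few non-neighbours. -/
theorem card_nonNeighbors_le (h : G.IsSubeigenvector ρ u y) (ht : 2 ≤ t) (hG : G.K2MinorFree t)
    (hcard : (Fintype.card V : ℝ) = m ^ 2 + 1) (hm : 1 ≤ m) (hρ : m / 2 ≤ ρ)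
    (hρ2 : m ^ 2 - 4 * t ^ 2 * m ≤ ρ ^ 2) : (#(G.nonNeighbors u) : ℝ) ≤ 12 * t ^ 2 * m := by
  have h1 := h.sum_le (a := 1 / 2) ht hG hcard hm (by norm_num) (by linarith)
  have h2 := h.sq_le (by linarith) hG
  have h3 := G.sum_realAdj_add_card_nonNeighbors u
  have h4 := mul_le_mul_of_nonneg_left h1 (t.cast_nonneg (α := ℝ))
  rw [hcard] at h3
  have h5 : (t : ℝ) * (4 * t * m / (1 / 2)) = 8 * t ^ 2 * m := by ring
  linarith

/-- If `ρ` is close to `m = √(n - 1)`, then all entries away from `u` are `O(1/m)`. -/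
theorem apply_le (h : G.IsSubeigenvector ρ u y) (ht : 2 ≤ t) (hG : G.K2MinorFree t)
    (hcard : (Fintype.card V : ℝ) = m ^ 2 + 1) (hm : 34 * t ^ 2 ≤ m) (hρ : m / 2 ≤ ρ)
    (hρ2 : m ^ 2 - 4 * t ^ 2 * m ≤ ρ ^ 2) {v : V} (hv : v ≠ u) : y v ≤ 16 * t ^ 2 / m := by
  have ht' : (2 : ℝ) ≤ t := by exact_mod_cast ht
  have hm1 : 1 ≤ m := by nlinarith
  have hm0 : 0 < m := by linarith
  have h1 := h.sum_le (a := 1 / 2) ht hG hcard hm1 (by norm_num) (by linarith)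
  have h2 := h.sq_mul_le (by linarith) hG v
  have h3 := h.card_nonNeighbors_le ht hG hcard hm1 hρ hρ2
  have h4 := hG.sum_realAdj_le hv
  have h5 := mul_le_mul_of_nonneg_left h1 (t.cast_nonneg (α := ℝ))
  have h6 : (t : ℝ) * (4 * t * m / (1 / 2)) = 8 * t ^ 2 * m := by ring
  have h7 : (t : ℝ) + 1 ≤ t ^ 2 * m := by nlinarith
  have h8 : m * (34 * t ^ 2) ≤ m * m := mul_le_mul_of_nonneg_left hm hm0.le
  have h9 : m ^ 2 / 2 * y v ≤ (ρ ^ 2 - ∑ w, G.realAdj v w) * y v :=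
    mul_le_mul_of_nonneg_right (by nlinarith) (h.nonneg v)
  rw [le_div_iff₀ hm0]
  refine le_of_mul_le_mul_left ?_ hm0
  nlinarith

/-- If `ρ` is close to `m = √(n - 1)`, then `ρ y v = O(1/m)` at the non-neighbours `v` of `u`; in
particular it is less than the entry at `u`. -/
theorem mul_lt_one_of_mem_nonNeighbors (h : G.IsSubeigenvector ρ u y) (ht : 2 ≤ t)
    (hG : G.K2MinorFree t) (hcard : (Fintype.card V : ℝ) = m ^ 2 + 1) (hm : 2000 * t ^ 5 ≤ m)
    (hρ : m / 2 ≤ ρ) (hρ2 : m ^ 2 - 4 * t ^ 2 * m ≤ ρ ^ 2) {v : V} (hv : v ∈ G.nonNeighbors u) :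
    ρ * y v < 1 := by
  have ht' : (2 : ℝ) ≤ t := by exact_mod_cast ht
  have ht1 : (1 : ℝ) ≤ t := by linarith
  have ht2 : (t : ℝ) ^ 2 ≤ t ^ 5 := pow_le_pow_right₀ ht1 (by norm_num)
  have ht3 : (t : ℝ) ^ 3 ≤ t ^ 5 := pow_le_pow_right₀ ht1 (by norm_num)
  have ht5 : (1 : ℝ) ≤ t ^ 5 := one_le_pow₀ ht1
  have hm0 : 0 < m := by linarith
  have hε : ∀ w ≠ u, y w ≤ 16 * t ^ 2 / m := fun w hw =>
    h.apply_le ht hG hcard (by linarith) hρ hρ2 hw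
  have h1 := h.mul_sum_nonNeighbors_le ht hG (by positivity) hε
  have h2 := h.card_nonNeighbors_le ht hG hcard (by linarith) hρ hρ2
  have h3 := h.mul_le_add_sum_nonNeighbors hG hε hv
  have h4 : (3 * t * (16 * t ^ 2 / m) * #(G.nonNeighbors u) : ℝ) ≤ 576 * t ^ 5 := by
    calc (3 * t * (16 * t ^ 2 / m) * #(G.nonNeighbors u) : ℝ)
        ≤ 3 * t * (16 * t ^ 2 / m) * (12 * t ^ 2 * m) := by gcongr
      _ = 576 * t ^ 5 := by field_simp; ring
  have h5 : ∑ w ∈ G.nonNeighbors u, y w ≤ 1152 * t ^ 5 / m := by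
    have h6 : m / 2 * ∑ w ∈ G.nonNeighbors u, y w ≤ ρ * ∑ w ∈ G.nonNeighbors u, y w :=
      mul_le_mul_of_nonneg_right hρ (Finset.sum_nonneg fun w _ => h.nonneg w)
    rw [le_div_iff₀ hm0]
    linarith
  have h6 : (t : ℝ) * (16 * t ^ 2 / m) + 1152 * t ^ 5 / m < 1 := by
    rw [← mul_div_assoc, ← add_div, div_lt_one hm0]
    linarith [show (t : ℝ) * (16 * t ^ 2) = 16 * t ^ 3 by ring]
  linarith

end IsSubeigenvector

variable [DecidableEq V]

/-- Two vertices of degree close to `n` would have too many common neighbours. -/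
theorem K2MinorFree.eq_of_card_nonNeighbors_le {G : SimpleGraph V} {t : ℕ} {m : ℝ} (ht : 2 ≤ t)
    (hG : G.K2MinorFree t) (hcard : (Fintype.card V : ℝ) = m ^ 2 + 1) (hm : 34 * t ^ 2 ≤ m)
    {u v : V} (hu : (#(G.nonNeighbors u) : ℝ) ≤ 12 * t ^ 2 * m)
    (hv : (#(G.nonNeighbors v) : ℝ) ≤ 12 * t ^ 2 * m) : u = v := by
  by_contra huv
  have ht' : (2 : ℝ) ≤ t := by exact_mod_cast ht
  have h1 := hG.sum_realAdj_le huv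
  have h2 := G.sum_realAdj_add_card_nonNeighbors u
  have h3 : m * (34 * t ^ 2) ≤ m * m := mul_le_mul_of_nonneg_left hm (by nlinarith)
  have h4 : (t : ℝ) + 1 < t ^ 2 * m := by
    nlinarith [mul_le_mul_of_nonneg_left (show 2 ≤ m by nlinarith) (sq_nonneg (t : ℝ))]
  nlinarith

end Subeigenvector

/-! ### Graphs of maximum spread -/

section MaxSpread

variable {V : Type*} [Fintype V] [DecidableEq V] {G : SimpleGraph V} {t : ℕ} {m : ℝ}

/-- In a graph of maximum spread on `n = m² + 1` vertices, `λ₁ ≥ m` and `-λₙ ≥ m - O(1)`: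
here `λ₁ - λₙ ≥ 2m` by comparison with the star, and `-λₙ ≤ λ₁ ≤ m + O(1)`. -/
theorem IsMaxSpread.lambdaOne_le_and_le_lambdaMin [Nonempty V] (ht : 2 ≤ t) (hG : G.IsMaxSpread t)
    (hcard : (Fintype.card V : ℝ) = m ^ 2 + 1) (hm : 1 ≤ m) :
    m ≤ G.lambdaOne ∧ G.lambdaMin ≤ -(m - 2 * t ^ 2) := by
  obtain ⟨c⟩ := ‹Nonempty V›
  have h1 := two_mul_le_spread_starAt c (by linarith) hcard
  have h2 := hG.2 (starAt c) (k2MinorFree_of_forall_adj ht c fun _ _ h => h.2)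
  have h3 := G.neg_lambdaMin_le_lambdaOne
  rw [G.spread_eq] at h2
  have h4 : m ≤ G.lambdaOne := by linarith
  obtain ⟨x, u, hx, hle, hu⟩ := G.exists_normalized_eigenvector G.lambdaOne_mem_spectrum
  have h5 := isSubeigenvector_abs hx hle hu
  rw [abs_of_nonneg (by linarith)] at h5
  have h6 := h5.sum_le (a := 1) ht hG.1 hcard hm one_pos (by linarith)
  have h7 := h5.sq_le (by linarith) hG.1
  have h8 := G.sum_realAdj_add_card_nonNeighbors u
  have h9 := mul_le_mul_of_nonneg_left h6 (t.cast_nonneg (α := ℝ))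
  have h10 : (0 : ℝ) ≤ #(G.nonNeighbors u) := Nat.cast_nonneg _
  have h11 : G.lambdaOne ≤ m + 2 * t ^ 2 := by
    refine le_of_sq_le_sq ?_ (by positivity)
    nlinarith [sq_nonneg ((t : ℝ) ^ 2)]
  exact ⟨h4, by linarith⟩

/-- If `x` is an eigenvector for `λ₁` with largest entry `x u = 1`, then `u` dominates: otherwise
turning a non-neighbour of `u` into a pendant neighbour of `u` would increase the spread. -/
theorem IsMaxSpread.nonNeighbors_eq_empty (ht : 2 ≤ t) (hG : G.IsMaxSpread t)
    (hcard : (Fintype.card V : ℝ) = m ^ 2 + 1) (hm : 2000 * t ^ 5 ≤ m) {x : V → ℝ} {u : V}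
    (hx : G.realAdj *ᵥ x = G.lambdaOne • x) (hle : ∀ v, |x v| ≤ 1) (hu : x u = 1) :
    G.nonNeighbors u = ∅ := by
  have : Nonempty V := ⟨u⟩
  have ht' : (2 : ℝ) ≤ t := by exact_mod_cast ht
  have ht1 : (1 : ℝ) ≤ t := by linarith
  have ht2 : (t : ℝ) ^ 2 ≤ t ^ 5 := pow_le_pow_right₀ ht1 (by norm_num)
  have ht5 : (1 : ℝ) ≤ t ^ 5 := one_le_pow₀ ht1
  have hm0 : 0 < m := by linarith
  obtain ⟨h1, h2⟩ := hG.lambdaOne_le_and_le_lambdaMin ht hcard (by linarith)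
  obtain ⟨z, w, hz, hzle, hw⟩ := G.exists_normalized_eigenvector G.lambdaMin_mem_spectrum
  have hpos : 0 < G.lambdaOne := by linarith
  have hneg : G.lambdaMin < 0 := by linarith
  have hX := isSubeigenvector_abs hx hle hu
  have hZ := isSubeigenvector_abs hz hzle hw
  have hX1 : m / 2 ≤ |G.lambdaOne| := by rw [abs_of_pos hpos]; linarith
  have hZ1 : m / 2 ≤ |G.lambdaMin| := by rw [abs_of_neg hneg]; linarith
  have hX2 : m ^ 2 - 4 * t ^ 2 * m ≤ |G.lambdaOne| ^ 2 := by
    rw [sq_abs]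
    nlinarith [mul_nonneg (sq_nonneg (t : ℝ)) hm0.le]
  have hZ2 : m ^ 2 - 4 * t ^ 2 * m ≤ |G.lambdaMin| ^ 2 := by
    have h3 : (m - 2 * t ^ 2) ^ 2 ≤ |G.lambdaMin| ^ 2 :=
      pow_le_pow_left₀ (by linarith) (by rw [abs_of_neg hneg]; linarith) 2
    nlinarith [sq_nonneg ((t : ℝ) ^ 2)]
  obtain rfl : u = w := hG.1.eq_of_card_nonNeighbors_le ht hcard (by linarith)
    (hX.card_nonNeighbors_le ht hG.1 hcard (by linarith) hX1 hX2)
    (hZ.card_nonNeighbors_le ht hG.1 hcard (by linarith) hZ1 hZ2)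
  by_contra hne
  obtain ⟨v, hv⟩ := nonempty_iff_ne_empty.2 hne
  have hXv := hX.mul_lt_one_of_mem_nonNeighbors ht hG.1 hcard hm hX1 hX2 hv
  have hZv := hZ.mul_lt_one_of_mem_nonNeighbors ht hG.1 hcard hm hZ1 hZ2 hv
  rw [← abs_mul] at hXv hZv
  exact (hG.2 _ (hG.1.movePendant ht v u)).not_gt <| spread_lt_spread_movePendant
    (mem_nonNeighbors.1 hv).1.symm hx hz hu hw hpos hneg hXv hZv

end MaxSpread

theorem degree_eq_of_nonNeighbors_eq_empty {V : Type*} [Fintype V] [DecidableEq V]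
    {G : SimpleGraph V} [DecidableRel G.Adj] {u : V} (h : G.nonNeighbors u = ∅) :
    G.degree u = Fintype.card V - 1 := by
  have : G.neighborFinset u = univ.erase u := by
    ext w
    simp only [mem_neighborFinset, mem_erase, mem_univ, and_true]
    refine ⟨fun hw => hw.ne', fun hw => ?_⟩
    by_contra hc
    exact notMem_empty w (h ▸ mem_nonNeighbors.2 ⟨hw, hc⟩)
  rw [← card_neighborFinset_eq_degree, this, card_erase_of_mem (mem_univ u), card_univ]

/-- Perron–Frobenius for a graph with a dominating vertex: if `x` is an eigenvector for `λ₁`, then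
so is `|x|`, and a zero entry would force the entry at the dominating vertex to vanish. -/
theorem isPerronVector_abs {V : Type*} [Fintype V] [DecidableEq V] {G : SimpleGraph V}
    {x : V → ℝ} {u : V} (hx : G.realAdj *ᵥ x = G.lambdaOne • x) (hle : ∀ v, |x v| ≤ 1)
    (hu : x u = 1) (h : G.nonNeighbors u = ∅) : G.IsPerronVector |x| := by
  classical
  have habs : G.realAdj *ᵥ |x| = G.lambdaOne • |x| := by
    refine G.mulVec_eq_of_lambdaOne_le ?_
    have h1 := G.abs_dotProduct_realAdj_mulVec_le x
    rw [hx, dotProduct_smul, smul_eq_mul] at h1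
    rw [abs_dotProduct_abs_self]
    exact (le_abs_self _).trans h1
  refine ⟨habs, fun v => ?_, hle, u, by simp [hu]⟩
  by_contra hv
  have hv0 : |x| v = 0 := le_antisymm (not_lt.1 hv) (abs_nonneg _)
  have hvu : v ≠ u := by
    rintro rfl
    simp [hu] at hv0
  have hadj : G.Adj v u := by
    by_contra hc
    exact notMem_empty v (h ▸ mem_nonNeighbors.2 ⟨hvu, fun h' => hc h'.symm⟩)
  have hsum := congrFun habs v
  rw [Pi.smul_apply, hv0, smul_zero, mulVec, dotProduct] at hsum
  have := (sum_eq_zero_iff_of_nonneg fun w _ =>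
    mul_nonneg (G.realAdj_nonneg v w) (abs_nonneg (x w))).1 hsum u (mem_univ u)
  simp [realAdj_apply, hadj, hu] at this

end SimpleGraph

theorem mainTheorem2 (t : ℕ) (ht : 2 ≤ t) :
    ∃ N : ℕ, ∀ n : ℕ, N ≤ n →
      ∀ (G : SimpleGraph (Fin n)) [DecidableRel G.Adj], G.IsMaxSpread t →
        (∃ u : Fin n, G.degree u = n - 1) ∧
        (∃ x : Fin n → ℝ, G.IsPerronVector x) ∧
        ∀ x : Fin n → ℝ, G.IsPerronVector x →
          ∀ u₀ : Fin n, x u₀ = 1 → G.degree u₀ = n - 1 := by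
  refine ⟨(2000 * t ^ 5) ^ 2 + 1, fun n hn G _ hG => ?_⟩
  have hn1 : (1 : ℝ) ≤ n := by exact_mod_cast (Nat.le_add_left 1 _).trans hn
  have hcard : (Fintype.card (Fin n) : ℝ) = √(n - 1 : ℝ) ^ 2 + 1 := by
    rw [Real.sq_sqrt (by linarith), Fintype.card_fin]
    ring
  have hm : 2000 * (t : ℝ) ^ 5 ≤ √(n - 1 : ℝ) := by
    refine Real.le_sqrt_of_sq_le ?_
    rw [le_sub_iff_add_le]
    exact_mod_cast hn
  have : Nonempty (Fin n) := ⟨⟨0, by omega⟩⟩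
  have hdeg : ∀ u, G.nonNeighbors u = ∅ → G.degree u = n - 1 := fun u hu => by
    simpa using SimpleGraph.degree_eq_of_nonNeighbors_eq_empty hu
  obtain ⟨x, u, hx, hle, hu⟩ := G.exists_normalized_eigenvector G.lambdaOne_mem_spectrum
  have hempty := hG.nonNeighbors_eq_empty ht hcard hm hx hle hu
  refine ⟨⟨u, hdeg u hempty⟩, ⟨|x|, SimpleGraph.isPerronVector_abs hx hle hu hempty⟩, ?_⟩
  rintro y ⟨hy, hpos, hyle, -⟩ u₀ hu₀
  exact hdeg u₀ (hG.nonNeighbors_eq_empty ht hcard hm hy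
    (fun v => (abs_of_pos (hpos v)).trans_le (hyle v)) hu₀)
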